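/- Let $(M_n)_{n\ge 0}$ be a weight sequence, that is, a sequence of positive real numbers with $M_0=1$ and $\frac{M_{n+m}}{M_nM_m}\ge\binom{n+m}{n}$ for all integers $n,m\ge 0$. Let $D([0,1],M)$ be the algebra, under pointwise operations, of all infinitely differentiable functions $f:[0,1]\to\mathbb{C}$ (with one-sided derivatives at the end points) such that $$\|f\|_D=\sum_{n=0}^\infty\frac{\|f^{(n)}\|_\infty}{M_n}<\infty,$$ where $\|\cdot\|_\infty$ is the supremum norm on $[0,1]$, and equip it with the norm $\|\cdot\|_D$. Let $\phi:[0,1]\to[0,1]$ be a map that induces a compact endomorphism $T$ of $D([0,1],M)$; that is, $f\circ\phi\in D([0,1],M)$ for every $f\in D([0,1],M)$, and the algebra endomorphism $Tf=f\circ\phi$ is a compact operator with respect to $\|\cdot\|_D$. Then every non-zero eigenvalue $\lambda\in\mathbb{C}$ of $T$ has geometric multiplicity one: the eigenspace $\{f\in D([0,1],M): f\circ\phi=\lambda f\}$ has complex dimension $1$. -/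

import Mathlib

open Set
open scoped ContDiff

noncomputable section

/-- A weight sequence: positive reals `M 0 = 1, M 1, M 2, …` with
`M (n + m) / (M n * M m) ≥ (n + m).choose n` for all `n`, `m`. -/
structure WeightSequence where
  /-- the terms of the sequence -/
  toFun : ℕ → ℝ
  pos : ∀ n, 0 < toFun n
  zero_eq_one : toFun 0 = 1
  choose_le : ∀ n m, ((n + m).choose n : ℝ) ≤ toFun (n + m) / (toFun n * toFun m)

instance : CoeFun WeightSequence (fun _ => ℕ → ℝ) := ⟨WeightSequence.toFun⟩

namespace DSpace

/-- A function on `[0,1]`, extended to `ℝ` by its end values. Only its values on `[0,1]` matter,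
because it is only differentiated within `[0,1]` below. -/
def extend (f : Icc (0 : ℝ) 1 → ℂ) : ℝ → ℂ := IccExtend zero_le_one f

/-- `f ∈ C^∞([0,1])`, with one-sided derivatives at the end points. -/
def IsSmooth (f : Icc (0 : ℝ) 1 → ℂ) : Prop := ContDiffOn ℝ ∞ (extend f) (Icc 0 1)

/-- The `n`-th derivative of `f` on `[0,1]`, one-sided at the end points. -/
def deriv (n : ℕ) (f : Icc (0 : ℝ) 1 → ℂ) (x : Icc (0 : ℝ) 1) : ℂ :=
  iteratedDerivWithin n (extend f) (Icc 0 1) x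

/-- `‖f^{(n)}‖_∞`, the supremum over `[0,1]`. -/
def supDeriv (n : ℕ) (f : Icc (0 : ℝ) 1 → ℂ) : ℝ := ⨆ x, ‖deriv n f x‖

/-- `f ∈ D([0,1], M)`: `f` is smooth and `∑ ‖f^{(n)}‖_∞ / M n < ∞`. -/
def Mem (M : WeightSequence) (f : Icc (0 : ℝ) 1 → ℂ) : Prop :=
  IsSmooth f ∧ Summable fun n => supDeriv n f / M n

/-- `‖f‖_D = ∑ ‖f^{(n)}‖_∞ / M n`. -/
def dnorm (M : WeightSequence) (f : Icc (0 : ℝ) 1 → ℂ) : ℝ := ∑' n, supDeriv n f / M n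

theorem uniqueDiff : UniqueDiffOn ℝ (Icc (0 : ℝ) 1) := uniqueDiffOn_Icc zero_lt_one

theorem IsSmooth.at {f : Icc (0 : ℝ) 1 → ℂ} (hf : IsSmooth f) (n : ℕ) (x : Icc (0 : ℝ) 1) :
    ContDiffWithinAt ℝ n (extend f) (Icc 0 1) x :=
  (hf x x.2).of_le (by exact_mod_cast le_top)

theorem deriv_add {f g : Icc (0 : ℝ) 1 → ℂ} (hf : IsSmooth f) (hg : IsSmooth g) (n : ℕ)
    (x : Icc (0 : ℝ) 1) : deriv n (f + g) x = deriv n f x + deriv n g x :=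
  iteratedDerivWithin_add x.2 uniqueDiff (hf.at n x) (hg.at n x)

theorem deriv_smul {f : Icc (0 : ℝ) 1 → ℂ} (hf : IsSmooth f) (c : ℂ) (n : ℕ)
    (x : Icc (0 : ℝ) 1) : deriv n (c • f) x = c • deriv n f x :=
  iteratedDerivWithin_const_smul x.2 uniqueDiff c (hf.at n x)

theorem deriv_const (c : ℂ) (n : ℕ) (x : Icc (0 : ℝ) 1) :
    deriv n (fun _ => c) x = if n = 0 then c else 0 :=
  iteratedDerivWithin_const

theorem norm_deriv_mul_le {f g : Icc (0 : ℝ) 1 → ℂ} (hf : IsSmooth f) (hg : IsSmooth g) (n : ℕ)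
    (x : Icc (0 : ℝ) 1) : ‖deriv n (f * g) x‖ ≤
      ∑ i ∈ Finset.range (n + 1), (n.choose i : ℝ) * ‖deriv i f x‖ * ‖deriv (n - i) g x‖ := by
  have h := norm_iteratedFDerivWithin_mul_le (n := n) hf hg uniqueDiff x.2
    (by exact_mod_cast le_top)
  simp only [norm_iteratedFDerivWithin_eq_norm_iteratedDerivWithin] at h
  exact h

theorem IsSmooth.norm_le {f : Icc (0 : ℝ) 1 → ℂ} (hf : IsSmooth f) (n : ℕ)
    (x : Icc (0 : ℝ) 1) : ‖deriv n f x‖ ≤ supDeriv n f := by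
  have hc : ContinuousOn (iteratedDerivWithin n (extend f) (Icc 0 1)) (Icc (0 : ℝ) 1) :=
    ContDiffOn.continuousOn_iteratedDerivWithin hf (by exact_mod_cast le_top) uniqueDiff
  have hc' : Continuous fun x : Icc (0 : ℝ) 1 => ‖deriv n f x‖ :=
    (continuousOn_iff_continuous_domRestrict.1 hc).norm
  exact le_ciSup (isCompact_range hc').bddAbove x

theorem supDeriv_nonneg (n : ℕ) (f : Icc (0 : ℝ) 1 → ℂ) : 0 ≤ supDeriv n f :=
  Real.iSup_nonneg fun _ => norm_nonneg _

theorem supDeriv_le {f : Icc (0 : ℝ) 1 → ℂ} {n : ℕ} {C : ℝ} (h : ∀ x, ‖deriv n f x‖ ≤ C) :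
    supDeriv n f ≤ C :=
  ciSup_le h

theorem supDeriv_const (c : ℂ) (n : ℕ) :
    supDeriv n (fun _ => c) = if n = 0 then ‖c‖ else 0 := by
  simp only [supDeriv, deriv_const]
  split_ifs <;> simp

theorem supDeriv_add_le {f g : Icc (0 : ℝ) 1 → ℂ} (hf : IsSmooth f) (hg : IsSmooth g) (n : ℕ) :
    supDeriv n (f + g) ≤ supDeriv n f + supDeriv n g :=
  supDeriv_le fun x => by
    rw [deriv_add hf hg]
    exact (norm_add_le _ _).trans (add_le_add (hf.norm_le n x) (hg.norm_le n x))

theorem supDeriv_smul {f : Icc (0 : ℝ) 1 → ℂ} (hf : IsSmooth f) (c : ℂ) (n : ℕ) :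
    supDeriv n (c • f) = ‖c‖ * supDeriv n f := by
  simp only [supDeriv, deriv_smul hf, norm_smul]
  exact (Real.mul_iSup_of_nonneg (norm_nonneg c) _).symm

theorem supDeriv_mul_div_le (M : WeightSequence) {f g : Icc (0 : ℝ) 1 → ℂ} (hf : IsSmooth f)
    (hg : IsSmooth g) (n : ℕ) : supDeriv n (f * g) / M n ≤
      ∑ i ∈ Finset.range (n + 1), (supDeriv i f / M i) * (supDeriv (n - i) g / M (n - i)) := by
  rw [div_le_iff₀ (M.pos n), Finset.sum_mul]
  refine supDeriv_le fun x => (norm_deriv_mul_le hf hg n x).trans (Finset.sum_le_sum fun i hi => ?_)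
  have hin : i + (n - i) = n := by
    have := Finset.mem_range.1 hi
    omega
  have hM := M.choose_le i (n - i)
  rw [hin] at hM
  have h1 : ‖deriv i f x‖ * ‖deriv (n - i) g x‖ ≤ supDeriv i f * supDeriv (n - i) g :=
    mul_le_mul (hf.norm_le i x) (hg.norm_le _ x) (norm_nonneg _) (supDeriv_nonneg _ _)
  calc (n.choose i : ℝ) * ‖deriv i f x‖ * ‖deriv (n - i) g x‖
      = (n.choose i : ℝ) * (‖deriv i f x‖ * ‖deriv (n - i) g x‖) := by ring
    _ ≤ (M n / (M i * M (n - i))) * (supDeriv i f * supDeriv (n - i) g) :=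
        mul_le_mul hM h1 (by positivity) (le_trans (Nat.cast_nonneg _) hM)
    _ = _ := by
        have := (M.pos i).ne'
        have := (M.pos (n - i)).ne'
        field_simp

theorem term_nonneg (M : WeightSequence) (f : Icc (0 : ℝ) 1 → ℂ) (n : ℕ) :
    0 ≤ supDeriv n f / M n :=
  div_nonneg (supDeriv_nonneg n f) (M.pos n).le

theorem hasSum_const (M : WeightSequence) (c : ℂ) :
    HasSum (fun n => supDeriv n (fun _ => c) / M n) ‖c‖ := by
  have h := hasSum_ite_eq (0 : ℕ) ‖c‖
  convert h using 2 with n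
  rw [supDeriv_const]
  split_ifs with hn
  · simp [hn, M.zero_eq_one]
  · simp

theorem mem_const (M : WeightSequence) (c : ℂ) : Mem M (fun _ => c) :=
  ⟨contDiffOn_const, (hasSum_const M c).summable⟩

theorem Mem.add_le {M : WeightSequence} {f g : Icc (0 : ℝ) 1 → ℂ} (hf : Mem M f) (hg : Mem M g)
    (n : ℕ) : supDeriv n (f + g) / M n ≤ supDeriv n f / M n + supDeriv n g / M n := by
  rw [← add_div]
  exact div_le_div_of_nonneg_right (supDeriv_add_le hf.1 hg.1 n) (M.pos n).le

theorem Mem.add {M : WeightSequence} {f g : Icc (0 : ℝ) 1 → ℂ} (hf : Mem M f) (hg : Mem M g) :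
    Mem M (f + g) :=
  ⟨ContDiffOn.add hf.1 hg.1,
    (hf.2.add hg.2).of_nonneg_of_le (term_nonneg M _) (hf.add_le hg)⟩

theorem Mem.mul {M : WeightSequence} {f g : Icc (0 : ℝ) 1 → ℂ} (hf : Mem M f) (hg : Mem M g) :
    Mem M (f * g) :=
  ⟨ContDiffOn.mul hf.1 hg.1,
    (hasSum_sum_range_mul_of_summable_norm hf.2.norm hg.2.norm).summable.of_nonneg_of_le
      (term_nonneg M _) (supDeriv_mul_div_le M hf.1 hg.1)⟩

theorem Mem.dnorm_add_le {M : WeightSequence} {f g : Icc (0 : ℝ) 1 → ℂ} (hf : Mem M f)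
    (hg : Mem M g) : dnorm M (f + g) ≤ dnorm M f + dnorm M g :=
  ((hf.add hg).2.tsum_le_tsum (hf.add_le hg) (hf.2.add hg.2)).trans_eq (hf.2.tsum_add hg.2)

theorem Mem.dnorm_mul_le {M : WeightSequence} {f g : Icc (0 : ℝ) 1 → ℂ} (hf : Mem M f)
    (hg : Mem M g) : dnorm M (f * g) ≤ dnorm M f * dnorm M g := by
  have h := hasSum_sum_range_mul_of_summable_norm hf.2.norm hg.2.norm
  have h2 := (hf.mul hg).2.tsum_le_tsum (supDeriv_mul_div_le M hf.1 hg.1) h.summable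
  rw [h.tsum_eq] at h2
  exact h2

theorem dnorm_smul {M : WeightSequence} {f : Icc (0 : ℝ) 1 → ℂ} (hf : IsSmooth f) (c : ℂ) :
    dnorm M (c • f) = ‖c‖ * dnorm M f := by
  simp only [dnorm, supDeriv_smul hf, mul_div_assoc, tsum_mul_left]

theorem Mem.eq_zero {M : WeightSequence} {f : Icc (0 : ℝ) 1 → ℂ} (hf : Mem M f)
    (h : dnorm M f = 0) : f = 0 := by
  have h0 := hf.2.le_tsum 0 fun n _ => term_nonneg M f n
  rw [show (∑' n, supDeriv n f / M n) = 0 from h, M.zero_eq_one, div_one] at h0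
  funext x
  have hx := (hf.1.norm_le 0 x).trans h0
  have hd : deriv 0 f x = f x := by simp [deriv, extend]
  rwa [hd, norm_le_zero_iff] at hx

/-- `D([0,1], M)` as a subalgebra of the complex functions on `[0,1]`. -/
def subalgebra (M : WeightSequence) : Subalgebra ℂ (Icc (0 : ℝ) 1 → ℂ) where
  carrier := {f | Mem M f}
  mul_mem' := Mem.mul
  add_mem' := Mem.add
  algebraMap_mem' := mem_const M

end DSpace

/-- The algebra `D([0,1], M)`, with pointwise operations and the norm `‖·‖_D` (not the
topology of pointwise convergence). -/
def DSpace (M : WeightSequence) : Type := ↥(DSpace.subalgebra M)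

namespace DSpace

variable {M : WeightSequence}

instance : CommRing (DSpace M) := inferInstanceAs (CommRing ↥(DSpace.subalgebra M))

instance : Algebra ℂ (DSpace M) := inferInstanceAs (Algebra ℂ ↥(DSpace.subalgebra M))

instance : CoeFun (DSpace M) (fun _ => Icc (0 : ℝ) 1 → ℂ) := ⟨Subtype.val⟩

theorem mem (f : DSpace M) : Mem M f := Subtype.property f

/-- `‖·‖_D` as a norm on the additive group of `D([0,1], M)`. -/
def addGroupNorm (M : WeightSequence) : AddGroupNorm (DSpace M) where
  toFun f := dnorm M f
  map_zero' := by
    have h := (hasSum_const M 0).tsum_eq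
    rw [norm_zero] at h
    exact h
  add_le' f g := (mem f).dnorm_add_le (mem g)
  neg' f := by
    have h := dnorm_smul (M := M) (mem f).1 (-1)
    rw [norm_neg, norm_one, one_mul, neg_one_smul] at h
    exact h
  eq_zero_of_map_eq_zero' f h := Subtype.ext ((mem f).eq_zero h)

instance : NormedCommRing (DSpace M) where
  __ := (addGroupNorm M).toNormedAddCommGroup
  __ := (inferInstance : CommRing (DSpace M))
  norm_mul_le f g := (mem f).dnorm_mul_le (mem g)

instance : NormedAlgebra ℂ (DSpace M) where
  norm_smul_le c f := (dnorm_smul (mem f).1 c).le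

theorem norm_def (f : DSpace M) : ‖f‖ = ∑' n, (⨆ x, ‖deriv n f x‖) / M n := rfl

/-- The selfmap `φ` of `[0,1]` induces the endomorphism `T` of `D([0,1], M)`: `T f = f ∘ φ`. -/
def Induces (φ : Icc (0 : ℝ) 1 → Icc (0 : ℝ) 1) (T : DSpace M →ₐ[ℂ] DSpace M) : Prop :=
  ∀ (f : DSpace M) (x : Icc (0 : ℝ) 1), T f x = f (φ x)

end DSpace

end

/-! Since `φ` is a continuous selfmap of `[0,1]`, it fixes some `p`; let `c = φ'(p)`. On functions
vanishing at `p` to order `k`, `T` multiplies the `k`-th derivative at `p` by `c ^ k`. Hence an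
eigenfunction for `μ ≠ 0` with a nonzero jet at `p` and order of vanishing `k` satisfies `c ^ k =
μ`.

Compactness enters through `Induces.norm_multiplier_lt_one`: every fixed point has `|c| < 1`. The
same holds for `T ∘ T`, so `φ ∘ φ` has only one fixed point, there are no 2-cycles, and every orbit
converges to `p` (`tendsto_iterate`), eventually at a geometric rate. An eigenfunction that is flat
at `p` would decay along orbits faster than any power of `|μ|`, so it is zero
(`Induces.eq_zero_of_eigen`).

Thus every nonzero eigenfunction has a finite order, and `|c| < 1` together with `c ^ k = μ ≠ 0`
determines that order. Two eigenfunctions are therefore proportional: subtracting a multiple that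
cancels the leading derivative would otherwise leave one of another order. -/

open Filter Topology Asymptotics

namespace DSpace

/-! ### Interval dynamics: uniqueness of the fixed point and convergence of orbits. -/

section Dynamics

/-- The fixed point `p` of `φ` is attracting at a linear rate. -/
def Attracting (φ : Icc (0 : ℝ) 1 → Icc (0 : ℝ) 1) (p : Icc (0 : ℝ) 1) : Prop :=
  ∃ r : ℝ, 0 < r ∧ r < 1 ∧ ∀ᶠ x in 𝓝 p, dist (φ x) p ≤ r * dist x p

variable {φ : Icc (0 : ℝ) 1 → Icc (0 : ℝ) 1} {p : Icc (0 : ℝ) 1}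

theorem Attracting.eventually_lt (h : Attracting φ p) :
    ∀ᶠ x in 𝓝 p, x ≠ p → dist (φ x) p < dist x p := by
  obtain ⟨r, -, hr1, h⟩ := h
  filter_upwards [h] with x hx hxp
  have := dist_pos.2 hxp
  nlinarith

theorem Attracting.eventually_lt_self (h : Attracting φ p) : ∀ᶠ x in 𝓝 p, p < x → φ x < x := by
  filter_upwards [h.eventually_lt] with x hx hpx
  have h1 := hx hpx.ne'
  rw [Subtype.dist_eq, Subtype.dist_eq, Real.dist_eq, Real.dist_eq] at h1
  have h2 : (p : ℝ) < x := hpx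
  rw [abs_of_pos (sub_pos.2 h2)] at h1
  have h3 := (abs_lt.1 h1).2
  exact Subtype.coe_lt_coe.1 (by linarith)

theorem Attracting.eventually_self_lt (h : Attracting φ p) : ∀ᶠ x in 𝓝 p, x < p → x < φ x := by
  filter_upwards [h.eventually_lt] with x hx hpx
  have h1 := hx hpx.ne
  rw [Subtype.dist_eq, Subtype.dist_eq, Real.dist_eq, Real.dist_eq] at h1
  have h2 : (x : ℝ) < p := hpx
  rw [abs_of_neg (sub_neg.2 h2)] at h1
  have h3 := (abs_lt.1 h1).1
  exact Subtype.coe_lt_coe.1 (by linarith)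

/-- A continuous selfmap of an interval all of whose fixed points are attracting has at most one
fixed point. -/
theorem fixedPt_unique (hφ : Continuous φ) (h : ∀ p, φ p = p → Attracting φ p)
    {p q : Icc (0 : ℝ) 1} (hp : φ p = p) (hq : φ q = q) : p = q := by
  wlog hpq : p < q generalizing p q
  · rcases (not_lt.1 hpq).eq_or_lt with h' | h'
    · exact h'.symm
    · exact (this hq hp h').symm
  -- The inequality `φ x ≤ x` spreads rightwards from `p`: by attraction at fixed points, by
  -- continuity elsewhere. It fails just to the left of `q`.
  have hsub : Icc p q ⊆ {x | φ x ≤ x} := by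
    refine IsClosed.Icc_subset_of_forall_mem_nhdsWithin
      ((isClosed_le hφ continuous_id).inter isClosed_Icc) hp.le ?_
    rintro x ⟨hx, -⟩
    rcases (show φ x ≤ x from hx).eq_or_lt with hx | hx
    · filter_upwards [nhdsWithin_le_nhds (h x hx).eventually_lt_self, self_mem_nhdsWithin]
        with y hy hxy
      exact (hy hxy).le
    · filter_upwards [nhdsWithin_le_nhds ((isOpen_lt hφ continuous_id).mem_nhds hx)] with y hy
      exact le_of_lt hy
  have hne : (𝓝[<] q).NeBot := nhdsLT_neBot_of_exists_lt ⟨p, hpq⟩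
  obtain ⟨x, hx1, hx2⟩ :=
    (((h q hq).eventually_self_lt.filter_mono (nhdsWithin_le_nhds (s := Iio q))).and
      (eventually_mem_set.2 (Ioo_mem_nhdsLT hpq))).exists
  exact absurd (hsub ⟨hx2.1.le, hx2.2.le⟩) (not_le.2 (hx1 hx2.2))

theorem self_lt_of_lt_fixedPt (hφ : Continuous φ) (hu : ∀ q, φ q = q → q = p)
    {x : Icc (0 : ℝ) 1} (hx : x < p) : x < φ x := by
  by_contra! hle
  obtain ⟨c, hc, hfix⟩ := exists_mem_Icc_isFixedPt (a := (⟨0, by simp⟩ : Icc (0 : ℝ) 1)) (b := x)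
    hφ.continuousOn x.2.1 (φ _).2.1 hle
  exact absurd (hu c hfix) (hc.2.trans_lt hx).ne

theorem lt_self_of_fixedPt_lt (hφ : Continuous φ) (hu : ∀ q, φ q = q → q = p)
    {x : Icc (0 : ℝ) 1} (hx : p < x) : φ x < x := by
  by_contra! hle
  obtain ⟨c, hc, hfix⟩ := exists_mem_Icc_isFixedPt (b := (⟨1, by simp⟩ : Icc (0 : ℝ) 1)) (a := x)
    hφ.continuousOn x.2.2 hle (φ _).2.2
  exact absurd (hu c hfix) (hx.trans_le hc.1).ne'

/-- If `φ ∘ φ` has no fixed point other than `p`, then `{p}` is the only nonempty compact set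
mapped onto itself by `φ`. -/
theorem subset_singleton_of_image_eq (hφ : Continuous φ) (hp : φ p = p)
    (hu : ∀ q, φ (φ q) = q → q = p) {K : Set (Icc (0 : ℝ) 1)} (hK : IsCompact K)
    (hKφ : φ '' K = K) : K ⊆ {p} := by
  rcases K.eq_empty_or_nonempty with rfl | hne
  · exact empty_subset _
  have hu1 : ∀ q, φ q = q → q = p := fun q hq => hu q (by rw [hq, hq])
  obtain ⟨a, haK, ha⟩ := hK.exists_isLeast hne
  obtain ⟨b, hbK, hb⟩ := hK.exists_isGreatest hne
  obtain ⟨s, hsK, hs⟩ : a ∈ φ '' K := hKφ.symm ▸ haK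
  obtain ⟨t, htK, ht⟩ : b ∈ φ '' K := hKφ.symm ▸ hbK
  have hmap : ∀ x ∈ K, φ x ∈ K := fun x hx => hKφ ▸ mem_image_of_mem φ hx
  -- Points to the right of `p` move left, so a maximum above `p` can only come from a point below
  -- `p`.
  have htb : p < b → t < p := by
    intro hpb
    rcases lt_trichotomy t p with h | h | h
    · exact h
    · exact absurd (ht.symm.trans (h ▸ hp)) hpb.ne'
    · have := lt_self_of_fixedPt_lt hφ hu1 h
      exact absurd (hb htK) (not_le.2 (ht ▸ this))
  have hap : p ≤ a := by
    by_contra! hap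
    have hps : p < s := by
      rcases lt_trichotomy s p with h | h | h
      · have := self_lt_of_lt_fixedPt hφ hu1 h
        exact absurd (ha hsK) (not_le.2 (hs ▸ this))
      · exact absurd (hs.symm.trans (h ▸ hp)) hap.ne
      · exact h
    have htp := htb (hps.trans_le (hb hsK))
    -- Here `φ (φ u) = φ s = a ≤ u` while `φ (φ a) ≥ a`, so `φ ∘ φ` has a fixed point in `[a, u]`.
    -- It must be `p`, which forces `u = p` and contradicts `φ u = s > p`.
    obtain ⟨u, hu', hus⟩ := intermediate_value_Icc' htp.le hφ.continuousOn
      (show s ∈ Icc (φ p) (φ t) from ⟨hp.symm ▸ hps.le, ht.symm ▸ hb hsK⟩)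
    have hau : a ≤ u := (ha htK).trans hu'.1
    obtain ⟨c, hc, hfix⟩ := exists_mem_Icc_isFixedPt (f := fun x => φ (φ x)) (a := a) (b := u)
      (hφ.comp hφ).continuousOn hau (ha (hmap _ (hmap _ haK))) (by simp only [hus, hs, hau])
    have hup : u = p := le_antisymm hu'.2 (hu c hfix ▸ hc.2)
    exact hps.ne (by rw [← hus, hup, hp])
  have hbp : b ≤ p := by
    by_contra! hpb
    exact absurd (htb hpb) (not_lt.2 (hap.trans (ha htK)))
  intro x hx
  exact le_antisymm ((hb hx).trans hbp) (hap.trans (ha hx))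

/-- The ranges of the iterates are nested compact sets whose intersection is mapped onto itself,
hence lies in `{p}`. By compactness some range lies inside any given neighbourhood of `p`. -/
theorem tendsto_iterate (hφ : Continuous φ) (hp : φ p = p)
    (hu : ∀ q, φ (φ q) = q → q = p) (x : Icc (0 : ℝ) 1) :
    Tendsto (fun n => φ^[n] x) atTop (𝓝 p) := by
  have hcpt : ∀ n, IsCompact (range φ^[n]) := fun n => isCompact_range (hφ.iterate n)
  have hanti : Antitone fun n => range φ^[n] := antitone_nat_of_succ_le fun n => by
    rw [Function.iterate_succ]
    exact range_comp_subset_range _ _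
  have himg : φ '' (⋂ n, range φ^[n]) = ⋂ n, range φ^[n] := by
    refine Subset.antisymm ?_ fun y hy => ?_
    · rintro _ ⟨x, hx, rfl⟩
      refine mem_iInter.2 fun n => hanti n.le_succ ?_
      obtain ⟨w, rfl⟩ := mem_iInter.1 hx n
      exact ⟨w, Function.iterate_succ_apply' φ n w⟩
    -- A preimage of `y` inside every range comes from Cantor intersection applied to the fibre over
    -- `y`.
    · have hcl : ∀ n, IsClosed (range φ^[n] ∩ φ ⁻¹' {y}) := fun n =>
        (hcpt n).isClosed.inter (isClosed_singleton.preimage hφ)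
      obtain ⟨w, hw⟩ := IsCompact.nonempty_iInter_of_sequence_nonempty_isCompact_isClosed
        (fun n => range φ^[n] ∩ φ ⁻¹' {y})
        (fun n => inter_subset_inter_left _ (hanti n.le_succ))
        (fun n => by
          obtain ⟨w, hw⟩ := mem_iInter.1 hy (n + 1)
          exact ⟨φ^[n] w, mem_range_self w, by rw [mem_preimage, ← Function.iterate_succ_apply' φ, hw,
            mem_singleton_iff]⟩)
        (hcl 0).isCompact hcl
      rw [← iInter_inter] at hw
      exact ⟨w, hw.1, hw.2⟩
  have hK := subset_singleton_of_image_eq hφ hp hu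
    (isClosed_iInter fun n => (hcpt n).isClosed).isCompact himg
  refine tendsto_def.2 fun U hU => ?_
  obtain ⟨N, hN⟩ := exists_subset_nhds_of_isCompact hanti.directed_ge hcpt (U := U)
    fun y hy => by rwa [mem_singleton_iff.1 (hK hy)]
  filter_upwards [eventually_ge_atTop N] with n hn
  exact hN (hanti hn (mem_range_self x))

/-- Orbits converging to an attracting fixed point do so at a geometric rate. -/
theorem Attracting.exists_dist_iterate_le (h : Attracting φ p) {x : Icc (0 : ℝ) 1}
    (hx : Tendsto (fun n => φ^[n] x) atTop (𝓝 p)) :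
    ∃ r : ℝ, 0 < r ∧ r < 1 ∧ ∃ n, ∀ m, dist (φ^[n + m] x) p ≤ r ^ m := by
  obtain ⟨r, hr0, hr1, h⟩ := h
  obtain ⟨n, hn⟩ := eventually_atTop.1 (hx.eventually h)
  refine ⟨r, hr0, hr1, n, fun m => ?_⟩
  induction m with
  | zero =>
    rw [pow_zero, Subtype.dist_eq]
    exact Real.dist_le_of_mem_Icc_01 (φ^[n + 0] x).2 p.2
  | succ m ih =>
    have := hn (n + m) (Nat.le_add_right n m)
    rw [← add_assoc, Function.iterate_succ_apply', pow_succ']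
    exact this.trans (by gcongr)

end Dynamics

/-! ### Jets at a point read off from asymptotics. -/

section Taylor

/-- The function `x ↦ x - p` on `[0,1]`, with complex values. -/
def shift (p x : Icc (0 : ℝ) 1) : ℂ := (x : ℝ) - (p : ℝ)

theorem norm_shift (p x : Icc (0 : ℝ) 1) : ‖shift p x‖ = dist x p := by
  rw [shift, ← Complex.ofReal_sub, Complex.norm_real, Subtype.dist_eq, Real.dist_eq,
    Real.norm_eq_abs]

theorem continuous_shift (p : Icc (0 : ℝ) 1) : Continuous (shift p) := by
  unfold shift
  fun_prop

/-- Taylor expansion at the first order where the jet of `f` may be nonzero. -/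
theorem isLittleO_sub_pow {f : Icc (0 : ℝ) 1 → ℂ} (hf : IsSmooth f) {k : ℕ}
    {p : Icc (0 : ℝ) 1} (h : ∀ j < k, deriv j f p = 0) :
    (fun x => f x - (deriv k f p / k.factorial) * shift p x ^ k) =o[𝓝 p]
      fun x => shift p x ^ k := by
  have h1 := taylor_isLittleO (n := k) (convex_Icc (0 : ℝ) 1) p.2
    (ContDiffOn.of_le hf (by exact_mod_cast le_top))
  have h2 := h1.comp_tendsto (k := fun x : Icc (0 : ℝ) 1 => (x : ℝ)) (l' := 𝓝 p)
    (by rw [nhds_subtype_eq_comap_nhdsWithin]; exact tendsto_comap)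
  refine (h2.congr_left fun x => ?_).trans_isBigO (isBigO_of_le _ fun x => ?_)
  · have hx : extend f x = f x := by simp [extend]
    simp only [Function.comp_apply, hx, taylor_within_apply]
    rw [Finset.sum_range_succ, Finset.sum_eq_zero, zero_add]
    · rw [Complex.real_smul, shift]
      push_cast
      rw [deriv]
      ring
    · intro j hj
      have := h j (Finset.mem_range.1 hj)
      rw [deriv] at this
      rw [this, smul_zero]
  · simp [norm_shift, Subtype.dist_eq, Real.dist_eq]

/-- The point `p` is not isolated in `[0,1]`, and `shift p` has no zero other than `p`. This makes
leading coefficients unique. -/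
theorem eq_zero_of_isLittleO_pow {a : ℂ} {k : ℕ} {p : Icc (0 : ℝ) 1}
    (h : (fun x => a * shift p x ^ k) =o[𝓝 p] fun x => shift p x ^ k) : a = 0 := by
  by_contra ha
  have h1 := (isLittleO_const_mul_left_iff ha).1 h
  have h2 := isLittleO_irrefl' (f' := fun x => shift p x ^ k) (l := 𝓝[≠] p)
    (Eventually.frequently <| by
      filter_upwards [self_mem_nhdsWithin] with x hx
      rw [norm_ne_zero_iff]
      refine pow_ne_zero _ (norm_ne_zero_iff.1 ?_)
      rw [norm_shift]
      exact dist_ne_zero.2 hx)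
  exact h2 (h1.mono nhdsWithin_le_nhds)

theorem isLittleO_shift_pow {j k : ℕ} (hjk : j < k) (p : Icc (0 : ℝ) 1) :
    (fun x => shift p x ^ k) =o[𝓝 p] fun x => shift p x ^ j := by
  have : Tendsto (shift p) (𝓝 p) (𝓝 0) := by
    have := (continuous_shift p).tendsto p
    rwa [show shift p p = 0 by simp [shift]] at this
  exact (isLittleO_pow_pow hjk).comp_tendsto this

theorem deriv_eq_zero_of_isBigO {f : Icc (0 : ℝ) 1 → ℂ} (hf : IsSmooth f) {k : ℕ}
    {p : Icc (0 : ℝ) 1} (h : f =O[𝓝 p] fun x => shift p x ^ k) {j : ℕ} (hj : j < k) :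
    deriv j f p = 0 := by
  induction j using Nat.strong_induction_on with
  | _ j ih =>
    have h1 := isLittleO_sub_pow hf (k := j) (p := p) fun i hi => ih i hi (hi.trans hj)
    have h2 := h.trans_isLittleO (isLittleO_shift_pow hj p)
    have h3 := eq_zero_of_isLittleO_pow ((h2.sub h1).congr_left fun x => sub_sub_cancel _ _)
    exact (div_eq_zero_iff.1 h3).resolve_right (by exact_mod_cast j.factorial_ne_zero)

/-- A function asymptotic to `a (x - p) ^ k` has the jet of `a (x - p) ^ k` up to order `k`. -/
theorem deriv_of_isLittleO {f : Icc (0 : ℝ) 1 → ℂ} (hf : IsSmooth f) {k : ℕ} {a : ℂ}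
    {p : Icc (0 : ℝ) 1}
    (h : (fun x => f x - a * shift p x ^ k) =o[𝓝 p] fun x => shift p x ^ k) :
    (∀ j < k, deriv j f p = 0) ∧ deriv k f p = k.factorial * a := by
  have hO : f =O[𝓝 p] fun x => shift p x ^ k :=
    (h.isBigO.add (isBigO_const_mul_self a _ _)).congr_left fun x => sub_add_cancel _ _
  have h0 : ∀ j < k, deriv j f p = 0 := fun j hj => deriv_eq_zero_of_isBigO hf hO hj
  refine ⟨h0, ?_⟩
  have h1 := eq_zero_of_isLittleO_pow (a := a - deriv k f p / k.factorial)
    (((isLittleO_sub_pow hf h0).sub h).congr_left fun x => by ring)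
  have hk : (k.factorial : ℂ) ≠ 0 := by exact_mod_cast k.factorial_ne_zero
  rw [sub_eq_zero.1 h1]
  field_simp

end Taylor

/-! ### Polynomials in `D([0,1], M)`. -/

section Coordinate

variable (M : WeightSequence)

theorem mem_coord : Mem M fun x => ((x : ℝ) : ℂ) := by
  have hs : ∀ x ∈ Icc (0 : ℝ) 1, extend (fun x => ((x : ℝ) : ℂ)) x = (x : ℂ) := fun x hx => by
    simp [extend, IccExtend_of_mem _ _ hx]
  refine ⟨Complex.ofRealCLM.contDiff.contDiffOn.congr hs, ?_⟩
  refine summable_of_ne_finset_zero (s := Finset.range 2) fun n hn => ?_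
  obtain ⟨m, rfl⟩ : ∃ m, n = m + 2 := ⟨n - 2, by simp at hn; omega⟩
  have : ∀ x, deriv (m + 2) (fun x => ((x : ℝ) : ℂ)) x = 0 := fun x => by
    rw [deriv, iteratedDerivWithin_congr hs x.2, iteratedDerivWithin_succ']
    have h1 : EqOn (derivWithin (fun x : ℝ => (x : ℂ)) (Icc 0 1)) (fun _ => 1) (Icc 0 1) :=
      fun y hy => (Complex.ofRealCLM.hasDerivWithinAt).derivWithin (uniqueDiff y hy)
    rw [iteratedDerivWithin_congr h1 x.2, iteratedDerivWithin_const]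
    simp
  simp [supDeriv, this]

/-- The coordinate function as an element of `D([0,1], M)`. -/
noncomputable def coord : DSpace M := ⟨fun x => ((x : ℝ) : ℂ), mem_coord M⟩

/-- The polynomial `(x - p) ^ k` as an element of `D([0,1], M)`. -/
noncomputable def shiftPow (p : Icc (0 : ℝ) 1) (k : ℕ) : DSpace M :=
  (coord M - algebraMap ℂ (DSpace M) (p : ℝ)) ^ k

theorem shiftPow_apply (p : Icc (0 : ℝ) 1) (k : ℕ) (x : Icc (0 : ℝ) 1) :
    shiftPow M p k x = shift p x ^ k := rfl

theorem deriv_shiftPow (p : Icc (0 : ℝ) 1) (k : ℕ) :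
    (∀ j < k, deriv j (shiftPow M p k) p = 0) ∧ deriv k (shiftPow M p k) p = k.factorial := by
  have := deriv_of_isLittleO (a := 1) (k := k) (p := p) (mem (shiftPow M p k)).1
    ((isLittleO_zero _ _).congr_left fun x => by rw [shiftPow_apply, one_mul, sub_self])
  rwa [mul_one] at this

end Coordinate

/-! ### Derivative evaluations and the filtration by order of vanishing. -/

section Functional

variable (M : WeightSequence)

theorem norm_deriv_le {M : WeightSequence} (k : ℕ) (p : Icc (0 : ℝ) 1) (f : DSpace M) :
    ‖deriv k f p‖ ≤ M k * ‖f‖ := by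
  have h := (mem f).2.le_tsum k fun n _ => term_nonneg M f n
  have h1 := (mem f).1.norm_le k p
  rw [div_le_iff₀' (M.pos k)] at h
  exact h1.trans h

/-- The continuous functional `f ↦ f^{(k)}(p)` on `D([0,1], M)`. -/
noncomputable def derivCLM (k : ℕ) (p : Icc (0 : ℝ) 1) : DSpace M →L[ℂ] ℂ :=
  LinearMap.mkContinuous
    { toFun := fun f => deriv k f p
      map_add' := fun f g => deriv_add (mem f).1 (mem g).1 k p
      map_smul' := fun c f => deriv_smul (mem f).1 c k p } (M k) (norm_deriv_le k p)

theorem derivCLM_apply (k : ℕ) (p : Icc (0 : ℝ) 1) (f : DSpace M) :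
    derivCLM M k p f = deriv k f p := rfl

/-- The functions in `D([0,1], M)` vanishing at `p` to order at least `k`. -/
noncomputable def vanishing (k : ℕ) (p : Icc (0 : ℝ) 1) : Submodule ℂ (DSpace M) :=
  ⨅ j < k, LinearMap.ker (derivCLM M j p).toLinearMap

theorem mem_vanishing {k : ℕ} {p : Icc (0 : ℝ) 1} {f : DSpace M} :
    f ∈ vanishing M k p ↔ ∀ j < k, deriv j f p = 0 := by
  simp [vanishing, Submodule.mem_iInf, derivCLM_apply]

end Functional

/-! ### The action of `T` on jets, and the consequences of compactness. -/

section Endomorphism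

variable {M : WeightSequence} {φ : Icc (0 : ℝ) 1 → Icc (0 : ℝ) 1} {T : DSpace M →ₐ[ℂ] DSpace M}

theorem Induces.comp {ψ : Icc (0 : ℝ) 1 → Icc (0 : ℝ) 1} {S : DSpace M →ₐ[ℂ] DSpace M}
    (hT : Induces φ T) (hS : Induces ψ S) : Induces (ψ ∘ φ) (T.comp S) := fun f x => by
  rw [AlgHom.comp_apply, hT, hS, Function.comp_apply]

theorem continuous_coe {f : Icc (0 : ℝ) 1 → ℂ} (hf : IsSmooth f) : Continuous f := by
  have h := continuousOn_iff_continuous_domRestrict.1 hf.continuousOn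
  convert h using 1
  funext x
  simp [extend]

theorem Induces.continuous (hT : Induces φ T) : Continuous φ := by
  rw [continuous_induced_rng]
  have h := Complex.continuous_re.comp (continuous_coe (mem (T (coord M))).1)
  convert h using 1
  funext x
  rw [Function.comp_apply, Function.comp_apply, hT]
  rfl

/-- The derivative of `φ` at `p`. -/
noncomputable def multiplier (T : DSpace M →ₐ[ℂ] DSpace M) (p : Icc (0 : ℝ) 1) : ℂ :=
  deriv 1 (T (shiftPow M p 1)) p

variable {p : Icc (0 : ℝ) 1}

theorem Induces.isLittleO_shift (hT : Induces φ T) (hp : φ p = p) :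
    (fun x => shift p (φ x) - multiplier T p * shift p x) =o[𝓝 p] shift p := by
  have h := isLittleO_sub_pow (k := 1) (p := p) (mem (T (shiftPow M p 1))).1 fun j hj => by
    obtain rfl : j = 0 := by omega
    simp [deriv, extend, hT (shiftPow M p 1) p, hp, shiftPow_apply, shift]
  simpa [hT (shiftPow M p 1), shiftPow_apply, multiplier] using h

theorem Induces.isBigO_shift (hT : Induces φ T) (hp : φ p = p) :
    (fun x => shift p (φ x)) =O[𝓝 p] shift p :=
  ((hT.isLittleO_shift hp).isBigO.add (isBigO_const_mul_self _ _ _)).congr_left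
    fun _ => sub_add_cancel _ _

theorem Induces.isLittleO_shift_pow (hT : Induces φ T) (hp : φ p = p) (k : ℕ) :
    (fun x => shift p (φ x) ^ k - multiplier T p ^ k * shift p x ^ k) =o[𝓝 p]
      fun x => shift p x ^ k := by
  induction k with
  | zero => exact (isLittleO_zero _ _).congr_left fun x => by simp
  | succ k ih =>
    have h1 := ih.mul_isBigO (hT.isBigO_shift hp)
    have h2 := (isBigO_const_mul_self (multiplier T p ^ k) (fun x => shift p x ^ k)
      (𝓝 p)).mul_isLittleO (hT.isLittleO_shift hp)
    simp only [pow_succ]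
    exact (h1.add h2).congr_left fun x => by ring

/-- `T` preserves the order of vanishing at a fixed point `p` of `φ` and multiplies the leading
derivative of order `k` by `φ'(p) ^ k`. -/
theorem Induces.deriv_apply (hT : Induces φ T) (hp : φ p = p) {k : ℕ} {f : DSpace M}
    (hf : f ∈ vanishing M k p) :
    T f ∈ vanishing M k p ∧ deriv k (T f) p = multiplier T p ^ k * deriv k f p := by
  rw [mem_vanishing] at hf ⊢
  have hφ : Tendsto φ (𝓝 p) (𝓝 p) := by
    have := hT.continuous.tendsto p
    rwa [hp] at this
  -- Substituting `φ` into the leading-order expansion of `f` avoids a chain rule for higher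
  -- derivatives.
  have h1 := ((isLittleO_sub_pow (mem f).1 hf).comp_tendsto hφ).trans_isBigO
    ((hT.isBigO_shift hp).pow k)
  have h2 := (hT.isLittleO_shift_pow hp k).const_mul_left (deriv k f p / k.factorial)
  have h := deriv_of_isLittleO (a := multiplier T p ^ k * deriv k f p / k.factorial)
    (mem (T f)).1 ((h1.add h2).congr_left fun x => by
      simp only [Function.comp_apply, hT f x]
      ring)
  refine ⟨h.1, h.2.trans ?_⟩
  have hk : (k.factorial : ℂ) ≠ 0 := by exact_mod_cast k.factorial_ne_zero
  field_simp

theorem vanishing_anti {k m : ℕ} (hkm : k ≤ m) : vanishing M m p ≤ vanishing M k p := fun _ hf =>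
  (mem_vanishing M).2 fun j hj => (mem_vanishing M).1 hf j (hj.trans_le hkm)

/-- Choose `f` in the unit ball nearly norming for `f ↦ f^{(k)}(p)` on `vanishing M k p`, attaining
more than half of the functional's norm. Any `g` there with the same value then has norm at least `1
/ 2`. -/
theorem exists_norming (M : WeightSequence) (p : Icc (0 : ℝ) 1) (k : ℕ) :
    ∃ f ∈ vanishing M k p, ‖f‖ ≤ 1 ∧
      ∀ g ∈ vanishing M k p, deriv k g p = deriv k f p → 1 / 2 ≤ ‖g‖ := by
  set l : vanishing M k p →L[ℂ] ℂ := (derivCLM M k p).comp (vanishing M k p).subtypeL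
  have hl : 0 < ‖l‖ := by
    refine (norm_nonneg l).lt_of_ne' fun hn => ?_
    have h := deriv_shiftPow M p k
    have h1 : l ⟨shiftPow M p k, (mem_vanishing M).2 h.1⟩ = k.factorial := h.2
    have h2 := l.le_opNorm ⟨shiftPow M p k, (mem_vanishing M).2 h.1⟩
    rw [hn, zero_mul, h1, norm_le_zero_iff] at h2
    exact k.factorial_ne_zero (by exact_mod_cast h2)
  obtain ⟨f, hf, hlf⟩ := l.exists_lt_apply_of_lt_opNorm (half_lt_self hl)
  refine ⟨f, f.2, hf.le, fun g hg hgf => ?_⟩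
  have h1 : l ⟨g, hg⟩ = l f := hgf
  have h2 : ‖l f‖ ≤ ‖l‖ * ‖g‖ := h1 ▸ l.le_opNorm ⟨g, hg⟩
  by_contra! hlt
  nlinarith

/-- If `|c| ≥ 1`, the images under `T` of the near-norming functions of all orders are `1 /
2`-separated, so they have no convergent subsequence. -/
theorem Induces.norm_multiplier_lt_one (hT : Induces φ T) (hc : IsCompactOperator T)
    (hp : φ p = p) : ‖multiplier T p‖ < 1 := by
  by_contra! hm
  choose f hfv hf1 hf using exists_norming M p
  have hsep : ∀ k m, k < m → 1 / 2 ≤ ‖T (f k) - T (f m)‖ := by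
    intro k m hkm
    have hk := hT.deriv_apply hp (hfv k)
    have hm' : T (f m) ∈ vanishing M (k + 1) p := vanishing_anti hkm (hT.deriv_apply hp (hfv m)).1
    have hm0 : deriv k (T (f m)) p = 0 := (mem_vanishing M).1 hm' k k.lt_succ_self
    have hc0 : multiplier T p ^ k ≠ 0 := pow_ne_zero _ (norm_pos_iff.1 (one_pos.trans_le hm))
    -- After division by `c ^ k` the difference has the same `k`-th derivative at `p` as `f k`,
    -- because `T (f m)` vanishes to higher order.
    have h := hf k ((multiplier T p ^ k)⁻¹ • (T (f k) - T (f m)))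
      (Submodule.smul_mem _ _ (Submodule.sub_mem _ hk.1 (vanishing_anti k.le_succ hm'))) (by
        rw [← derivCLM_apply, map_smul, map_sub, derivCLM_apply, derivCLM_apply, hm0, hk.2,
          sub_zero, smul_eq_mul, inv_mul_cancel_left₀ hc0])
    rw [norm_smul, norm_inv, norm_pow] at h
    exact h.trans (mul_le_of_le_one_left (norm_nonneg _) (inv_le_one_of_one_le₀ (one_le_pow₀ hm)))
  have hK := IsCompactOperator.isCompact_closure_image_closedBall
    (f := T.toLinearMap) hc 1
  obtain ⟨g, -, σ, hσ, hg⟩ := hK.tendsto_subseq (x := fun n => T (f n)) fun n =>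
    subset_closure ⟨f n, mem_closedBall_zero_iff.2 (hf1 n), rfl⟩
  obtain ⟨N, hN⟩ := Metric.cauchySeq_iff'.1 hg.cauchySeq (1 / 2) one_half_pos
  have h1 := hN (N + 1) N.le_succ
  rw [dist_comm, dist_eq_norm] at h1
  exact absurd (hsep _ _ (hσ N.lt_succ_self)) (not_le.2 h1)

theorem Induces.attracting (hT : Induces φ T) (hc : IsCompactOperator T) (hp : φ p = p) :
    Attracting φ p := by
  have hm := hT.norm_multiplier_lt_one hc hp
  set c := multiplier T p with hcdef
  refine ⟨(1 + ‖c‖) / 2, by positivity, by linarith, ?_⟩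
  filter_upwards [(hT.isLittleO_shift hp).bound (show 0 < (1 - ‖c‖) / 2 by linarith)] with x hx
  have h1 := norm_add_le (shift p (φ x) - c * shift p x) (c * shift p x)
  rw [sub_add_cancel, norm_mul] at h1
  rw [norm_shift] at h1 hx
  rw [norm_shift] at h1
  linarith

theorem Induces.tendsto_iterate (hT : Induces φ T) (hc : IsCompactOperator T) (hp : φ p = p)
    (x : Icc (0 : ℝ) 1) : Tendsto (fun n => φ^[n] x) atTop (𝓝 p) := by
  have hcont : Continuous T := IsCompactOperator.continuous (f := T.toLinearMap) hc
  -- Passing to `T ∘ T` makes every fixed point of `φ ∘ φ` attracting, which excludes 2-cycles of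
  -- `φ`.
  have hc2 : IsCompactOperator (T.comp T) := hc.continuous_comp hcont
  have hT2 := hT.comp hT
  exact DSpace.tendsto_iterate hT.continuous hp (fun q hq => fixedPt_unique hT2.continuous
    (fun q hq => hT2.attracting hc2 hq) hq (show φ (φ p) = p by rw [hp, hp])) x

theorem Induces.apply_iterate (hT : Induces φ T) {μ : ℂ} {f : DSpace M} (hf : T f = μ • f) (n : ℕ)
    (x : Icc (0 : ℝ) 1) : f (φ^[n] x) = μ ^ n * f x := by
  induction n with
  | zero => simp
  | succ n ih =>
    rw [Function.iterate_succ_apply', ← hT, hf, pow_succ', mul_assoc, ← ih]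
    rfl

/-- An eigenfunction for a nonzero eigenvalue that vanishes to infinite order at the fixed point
is zero. -/
theorem Induces.eq_zero_of_eigen (hT : Induces φ T) (hc : IsCompactOperator T) (hp : φ p = p)
    {μ : ℂ} (hμ : μ ≠ 0) {f : DSpace M} (hf : T f = μ • f) (h0 : ∀ k, deriv k f p = 0) :
    f = 0 := by
  refine Subtype.ext (funext fun x => ?_)
  show f x = 0
  have hμ' : 0 < ‖μ‖ := norm_pos_iff.2 hμ
  have htend := hT.tendsto_iterate hc hp x
  obtain ⟨r, hr0, hr1, n, hn⟩ := (hT.attracting hc hp).exists_dist_iterate_le htend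
  -- With `r ^ N < |μ|`, flatness to order `N` makes `f` decay along the orbit like `r ^ (N * m)`,
  -- whereas the eigenvalue equation gives exactly `|μ| ^ (n + m) * |f x|`.
  obtain ⟨N, hN⟩ := exists_pow_lt_of_lt_one hμ' hr1
  have hlo : f =o[𝓝 p] fun x => shift p x ^ N :=
    (isLittleO_sub_pow (k := N) (mem f).1 fun j _ => h0 j).congr_left fun x => by simp [h0]
  have hev : ∀ᶠ m in atTop, ‖f x‖ * ‖μ‖ ^ n ≤ (r ^ N / ‖μ‖) ^ m := by
    have hshift : Tendsto (fun m => φ^[n + m] x) atTop (𝓝 p) :=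
      htend.comp (tendsto_atTop_mono (fun m => Nat.le_add_left m n) tendsto_id)
    filter_upwards [hshift.eventually (hlo.bound one_pos)] with m hm
    rw [hT.apply_iterate hf, norm_mul, norm_pow, norm_pow, norm_shift, one_mul] at hm
    rw [div_pow, le_div_iff₀ (by positivity)]
    calc ‖f x‖ * ‖μ‖ ^ n * ‖μ‖ ^ m = ‖μ‖ ^ (n + m) * ‖f x‖ := by ring
      _ ≤ (r ^ m) ^ N := hm.trans (pow_le_pow_left₀ dist_nonneg (hn m) N)
      _ = (r ^ N) ^ m := by rw [← pow_mul, ← pow_mul, mul_comm]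
  have hlim : Tendsto (fun m => (r ^ N / ‖μ‖) ^ m) atTop (𝓝 0) :=
    tendsto_pow_atTop_nhds_zero_of_lt_one (by positivity) ((div_lt_one hμ').2 hN)
  have hle := ge_of_tendsto hlim hev
  have hpos : 0 < ‖μ‖ ^ n := by positivity
  exact norm_le_zero_iff.1 (nonpos_of_mul_nonpos_left hle hpos)

/-- A nonzero eigenfunction has a nonzero derivative at the fixed point, and the order `k` of the
first one satisfies `φ'(p) ^ k = μ`. -/
theorem Induces.exists_order (hT : Induces φ T) (hc : IsCompactOperator T) (hp : φ p = p)
    {μ : ℂ} (hμ : μ ≠ 0) {f : DSpace M} (hf : T f = μ • f) (hf0 : f ≠ 0) :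
    ∃ k, deriv k f p ≠ 0 ∧ multiplier T p ^ k = μ := by
  classical
  have hex : ∃ k, deriv k f p ≠ 0 := by
    by_contra! h
    exact hf0 (hT.eq_zero_of_eigen hc hp hμ hf h)
  refine ⟨Nat.find hex, Nat.find_spec hex, ?_⟩
  have h := (hT.deriv_apply hp (k := Nat.find hex) (f := f)
    ((mem_vanishing M).2 fun j hj => not_not.1 (Nat.find_min hex hj))).2
  rw [hf, ← derivCLM_apply, map_smul, derivCLM_apply, smul_eq_mul] at h
  exact (mul_right_cancel₀ (Nat.find_spec hex) h).symm

end Endomorphism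

end DSpace

/-! ### One-dimensionality of the eigenspace. -/

theorem theorem2p5 (M : WeightSequence) (φ : Set.Icc (0 : ℝ) 1 → Set.Icc (0 : ℝ) 1)
    (T : DSpace M →ₐ[ℂ] DSpace M) (hT : DSpace.Induces φ T) (hc : IsCompactOperator T)
    (μ : ℂ) (hμ : μ ≠ 0) (hev : Module.End.HasEigenvalue T.toLinearMap μ) :
    Module.finrank ℂ (Module.End.eigenspace T.toLinearMap μ) = 1 := by
  obtain ⟨p, -, hp⟩ := exists_mem_Icc_isFixedPt (f := φ) (a := ⟨0, by simp⟩) (b := ⟨1, by simp⟩)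
    hT.continuous.continuousOn (Subtype.mk_le_mk.2 zero_le_one) (φ _).2.1 (φ _).2.2
  obtain ⟨f, hf⟩ := hev.exists_hasEigenvector
  have hc1 := hT.norm_multiplier_lt_one hc hp
  obtain ⟨k, hfk, hk⟩ := hT.exists_order hc hp hμ hf.apply_eq_smul hf.2
  refine finrank_eq_one (⟨f, hf.1⟩ : Module.End.eigenspace T.toLinearMap μ)
    (fun h => hf.2 (congrArg Subtype.val h)) fun ⟨g, hg⟩ =>
      ⟨DSpace.deriv k g p / DSpace.deriv k f p, Subtype.ext ?_⟩
  -- This ratio makes the `k`-th derivative of `g - a • f` vanish at `p`, so a nonzero difference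
  -- would give an exponent `l ≠ k` with `c ^ l = μ`.
  set a := DSpace.deriv k g p / DSpace.deriv k f p with ha
  by_contra hne
  have hh : g - a • f ∈ Module.End.eigenspace T.toLinearMap μ :=
    Submodule.sub_mem _ hg (Submodule.smul_mem _ _ hf.1)
  obtain ⟨l, hl0, hl⟩ := hT.exists_order hc hp hμ (Module.End.mem_eigenspace_iff.1 hh)
    (sub_ne_zero.2 (Ne.symm hne))
  have hlk : l ≠ k := by
    rintro rfl
    refine hl0 ?_
    rw [← DSpace.derivCLM_apply, map_sub, map_smul, DSpace.derivCLM_apply, DSpace.derivCLM_apply,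
      smul_eq_mul, ha, div_mul_cancel₀ _ hfk, sub_self]
  have h0 : 0 < ‖DSpace.multiplier T p‖ ∨ DSpace.multiplier T p = 0 := by
    rw [norm_pos_iff]
    exact ne_or_eq _ _
  rcases h0 with h0 | h0
  · exact hlk (pow_right_injective₀ h0 hc1.ne (by simp only [← norm_pow, hl, hk]))
  -- If `c = 0`, powers are not injective, but `0 ^ m = μ ≠ 0` leaves only `m = 0`.
  · have : ∀ m, DSpace.multiplier T p ^ m = μ → m = 0 := fun m hm => by
      by_contra hm0
      rw [h0, zero_pow hm0] at hm
      exact hμ hm.symm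
    exact hlk ((this l hl).trans (this k hk).symm)
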